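/- For a group $G$, the power graph $\mathcal P(G)$ (respectively the enhanced power graph $\mathcal P_e(G)$) is the simple graph with vertex set $G$ in which two distinct elements are adjacent if and only if one of them is a power of the other (respectively, if and only if they belong to a common cyclic subgroup of $G$). The independence number $\alpha(\Gamma)$ of a graph $\Gamma$ is the largest cardinality of a set of pairwise non-adjacent vertices. A maximal cyclic subgroup of $G$ is a cyclic subgroup that is not properly contained in another cyclic subgroup, and $\mu(G)$ denotes the number of maximal cyclic subgroups of $G$. Let $p$ be a prime, let $s \ge 1$, and let $\alpha_1 > \dots > \alpha_s$ and $m_1, \dots, m_s$ be positive integers. For $0 \le j \le s$ put $n_j = p^{\sum_{i=1}^{j} m_i\alpha_i}$ and $r_j = \sum_{i=1}^{j} m_i$ (so $n_0 = 1$, $r_0 = 0$), and let $n = n_s$, $r = r_s$. Define $$F_p(\alpha_1,\dots,\alpha_s; m_1,\dots,m_s) = \sum_{t=1}^{r} \frac{n}{p^{t-1}} \left\{ \frac{p^{(r_k-1)\alpha_k}}{n_k} + \mu_k \right\},$$ where, for each $t$, $k = k(t)$ is the index with $1 \le k \le s$ and $r_{k-1} < t \le r_k$, and $$\mu_k = \sum_{j=1}^{k-1}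 \frac{p^{r_j}-1}{n_j} \sum_{\beta=\alpha_{j+1}}^{\alpha_j-1} p^{(r_j-1)\beta} \quad (k>1), \qquad \mu_1 = 0.$$ (i) If $G$ is a (nontrivial) finite abelian $p$-group with $G \cong \mathbb Z_{p^{\alpha_1}}^{m_1} \times \cdots \times \mathbb Z_{p^{\alpha_s}}^{m_s}$, then $$\alpha(\mathcal P(G)) = \alpha(\mathcal P_e(G)) = \mu(G) = F_p(\alpha_1,\dots,\alpha_s; m_1,\dots,m_s).$$ (ii) If $G$ is any finite abelian group and, for each prime $p$ dividing $|G|$, $P_p$ is the Sylow $p$-subgroup of $G$, then $$\alpha(\mathcal P_e(G)) = \prod_{p \,\mid\, |G|} \mu(P_p).$$ Consequently, if for each prime $p$ dividing $|G|$ one has $P_p \cong \mathbb Z_{p^{\alpha_{p,1}}}^{m_{p,1}} \times \cdots \times \mathbb Z_{p^{\alpha_{p,s_p}}}^{m_{p,s_p}}$ with $s_p \ge 1$, positive integers $\alpha_{p,1} > \dots > \alpha_{p,s_p}$ and positive integers $m_{p,1},\dots,m_{p,s_p}$, then $$\alpha(\mathcal P_e(G)) = \prod_{p \,\mid\, |G|}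 F_p(\alpha_{p,1},\dots,\alpha_{p,s_p}; m_{p,1},\dots,m_{p,s_p}).$$ -/

import Mathlib

universe u

/-- The power graph of a group: distinct elements are adjacent iff one is a power of the other. -/
def powerGraph (G : Type*) [Group G] : SimpleGraph G where
  Adj x y := x ≠ y ∧ ((∃ a : ℕ, y = x ^ a) ∨ ∃ a : ℕ, x = y ^ a)
  symm := ⟨fun _ _ h => ⟨h.1.symm, h.2.symm⟩⟩
  loopless := ⟨fun _ h => h.1 rfl⟩

/-- The enhanced power graph of a group: distinct elements are adjacent iff they belong to a
common cyclic subgroup. -/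
def enhancedPowerGraph (G : Type*) [Group G] : SimpleGraph G where
  Adj x y := x ≠ y ∧ ∃ C : Subgroup G, IsCyclic C ∧ x ∈ C ∧ y ∈ C
  symm := ⟨fun _ _ h => ⟨h.1.symm, h.2.imp fun _ hC => ⟨hC.1, hC.2.2, hC.2.1⟩⟩⟩
  loopless := ⟨fun _ h => h.1 rfl⟩

/-- The number of maximal cyclic subgroups of `G`, i.e. of cyclic subgroups that are contained in
no other cyclic subgroup. -/
noncomputable def numMaxCyclic (G : Type*) [Group G] : ℕ :=
  {H : Subgroup G | Maximal (fun K : Subgroup G => IsCyclic K) H}.ncard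

/-- The integers `α_1 > ⋯ > α_s` and `m_1, …, m_s` are positive, and there is at least one of each.
The sequences are indexed by `1, …, s`; values at other indices are irrelevant. -/
structure IsTypeData (s : ℕ) (α m : ℕ → ℕ) : Prop where
  one_le : 1 ≤ s
  strictAnti : StrictAntiOn α (Set.Icc 1 s)
  α_pos : ∀ i ∈ Set.Icc 1 s, 0 < α i
  m_pos : ∀ i ∈ Set.Icc 1 s, 0 < m i

/-- The group `ℤ_{p^{α_1}}^{m_1} × ⋯ × ℤ_{p^{α_s}}^{m_s}`, written multiplicatively. -/
abbrev StdPGroup (p s : ℕ) (α m : ℕ → ℕ) : Type :=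
  Multiplicative ((i : Finset.Icc 1 s) → Fin (m i) → ZMod (p ^ α i))

/-- `r_j = m_1 + ⋯ + m_j`, with `r_0 = 0`. -/
def rSum (m : ℕ → ℕ) (j : ℕ) : ℕ := ∑ i ∈ Finset.Icc 1 j, m i

/-- `n_j = p ^ (m_1 α_1 + ⋯ + m_j α_j)`, with `n_0 = 1`. -/
def nProd (p : ℕ) (α m : ℕ → ℕ) (j : ℕ) : ℕ := p ^ ∑ i ∈ Finset.Icc 1 j, m i * α i

/-- For `1 ≤ t ≤ r_s`, the index `k` with `r_{k-1} < t ≤ r_k`; see `blockIndex_eq_iff`. -/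
noncomputable def blockIndex (m : ℕ → ℕ) (t : ℕ) : ℕ := sInf {k | t ≤ rSum m k}

theorem rSum_mono (m : ℕ → ℕ) : Monotone (rSum m) := fun _ _ h =>
  Finset.sum_le_sum_of_subset (Finset.Icc_subset_Icc_right h)

theorem blockIndex_eq_iff {s t : ℕ} (m : ℕ → ℕ) (ht : 1 ≤ t) (hts : t ≤ rSum m s) (k : ℕ) :
    blockIndex m t = k ↔ k ∈ Set.Icc 1 s ∧ rSum m (k - 1) < t ∧ t ≤ rSum m k := by
  have hmem : t ≤ rSum m (blockIndex m t) := Nat.sInf_mem (s := {k | t ≤ rSum m k}) ⟨s, hts⟩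
  have hle : ∀ l, t ≤ rSum m l → blockIndex m t ≤ l := fun l hl => Nat.sInf_le hl
  have h0 : rSum m 0 = 0 := by simp [rSum]
  constructor
  · rintro rfl
    have h1 : 1 ≤ blockIndex m t := by
      by_contra h
      have : blockIndex m t = 0 := by omega
      rw [this, h0] at hmem
      omega
    refine ⟨⟨h1, hle s hts⟩, ?_, hmem⟩
    by_contra h
    have := hle _ (not_lt.mp h)
    omega
  · rintro ⟨⟨hk1, -⟩, hlt, hk⟩
    refine le_antisymm (hle k hk) ?_
    by_contra h
    have := rSum_mono m (show blockIndex m t ≤ k - 1 by omega)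
    omega

/-- `μ_k`. The inner sum runs over `α_{j+1} ≤ β ≤ α_j - 1`. -/
def muTerm (p : ℕ) (α m : ℕ → ℕ) (k : ℕ) : ℚ :=
  if 1 < k then
    ∑ j ∈ Finset.Icc 1 (k - 1), ((p : ℚ) ^ rSum m j - 1) / (nProd p α m j : ℚ) *
      ∑ β ∈ Finset.Ico (α (j + 1)) (α j), (p : ℚ) ^ ((rSum m j - 1) * β)
  else 0

/-- `∑_{t=1}^{r} (n / p^{t-1}) (p^{(r_k - 1) α_k} / n_k + μ_k)` with `n = n_s`, `r = r_s` and
`r_{k-1} < t ≤ r_k`. -/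
noncomputable def indepFormula (p s : ℕ) (α m : ℕ → ℕ) : ℚ :=
  ∑ t ∈ Finset.Icc 1 (rSum m s),
    (nProd p α m s : ℚ) / (p : ℚ) ^ (t - 1) *
      ((p : ℚ) ^ ((rSum m (blockIndex m t) - 1) * α (blockIndex m t)) /
          (nProd p α m (blockIndex m t) : ℚ) +
        muTerm p α m (blockIndex m t))

/-! In a finite group, sending each vertex of an independent set of the enhanced power graph to a
maximal cyclic subgroup containing it is injective. Conversely, generators of distinct maximal
cyclic subgroups are never adjacent, so the independence number is the number of these subgroups. In
a finite `p`-group the subgroups of a cyclic group form a chain, so both graphs coincide. Subgroups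
of a product of groups of coprime orders are products, so the count is multiplicative over Sylow
subgroups.

In a nontrivial finite abelian `p`-group, `g` generates a maximal cyclic subgroup iff it is not a
`p`-th power. With `A e` the number of elements killed by `p ^ e`, exactly `A (e + 1) / A 1` of the
`p`-th powers are killed by `p ^ e`. Counting generators by order and dividing by the totient gives
`numMaxCyclic_eq_sum_card_torsion`.

Here `A e = p ^ torsionExp s α m e`. `n` times the braces of the stated formula is `torsionSum` at
`α k`, and is constant on each block of `t`. Geometric sums over the blocks and summation by parts
bring the formula (`IsTypeData.indepFormula_eq`) and the count (`sum_range_eq_torsionSum`) to the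
same closed form. -/

/-! ### Independent sets and maximal cyclic subgroups. -/

theorem IsCyclic.exists_eq_zpowers {G : Type*} [Group G] {H : Subgroup G} (h : IsCyclic H) :
    ∃ g : G, H = Subgroup.zpowers g := by
  obtain ⟨g, hg⟩ := (Subgroup.isCyclic_iff_exists_zpowers_eq_top H).1 h
  exact ⟨g, hg.symm⟩

theorem exists_maximal_isCyclic_ge {G : Type*} [Group G] [Finite G] {H : Subgroup G}
    (h : IsCyclic H) : ∃ M, H ≤ M ∧ Maximal (fun K : Subgroup G => IsCyclic K) M :=
  (Set.toFinite {K : Subgroup G | IsCyclic K}).exists_le_maximal h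

/-- In a finite group, the independence number of the enhanced power graph is the number of maximal
cyclic subgroups. -/
theorem indepNum_enhancedPowerGraph (G : Type*) [Group G] [Finite G] :
    (enhancedPowerGraph G).indepNum = numMaxCyclic G := by
  classical
  set S := {H : Subgroup G | Maximal (fun K : Subgroup G => IsCyclic K) H} with hS
  have hfin : S.Finite := Set.toFinite S
  apply le_antisymm
  · obtain ⟨t, ht⟩ := (enhancedPowerGraph G).exists_isNIndepSet_indepNum
    rw [← ht.card_eq]
    have hM : ∀ x : G, ∃ M ∈ S, x ∈ M := fun x => by
      obtain ⟨M, hxM, hM⟩ := exists_maximal_isCyclic_ge (H := Subgroup.zpowers x) inferInstance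
      exact ⟨M, hM, hxM (Subgroup.mem_zpowers x)⟩
    choose M hMS hxM using hM
    rw [numMaxCyclic, ← Set.ncard_coe_finset]
    refine Set.ncard_le_ncard_of_injOn M (fun x _ => hMS x) (fun x hx y hy hxy => ?_) hfin
    by_contra hne
    exact ht.isIndepSet hx hy hne ⟨hne, M x, (hMS x).1, hxM x, hxy ▸ hxM y⟩
  · have hg : ∀ M : S, ∃ g : G, M.1 = Subgroup.zpowers g := fun M =>
      IsCyclic.exists_eq_zpowers M.2.1
    choose g hg using hg
    have hinj : Function.Injective g := fun M N h => Subtype.ext (by rw [hg M, hg N, h])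
    have : Fintype S := hfin.fintype
    have hle : (Finset.univ.image g).card ≤ (enhancedPowerGraph G).indepNum := by
      apply SimpleGraph.IsIndepSet.card_le_indepNum
      intro x hx y hy hne
      simp only [Finset.coe_image, Finset.coe_univ, Set.image_univ, Set.mem_range] at hx hy
      obtain ⟨M, rfl⟩ := hx
      obtain ⟨N, rfl⟩ := hy
      rintro ⟨-, C, hC, h1, h2⟩
      have hMC : M.1 = C :=
        Maximal.eq_of_le (show Maximal (fun K : Subgroup G => IsCyclic K) M.1 from M.2) hC
          (by rw [hg M]; simpa using h1)
      have hNC : N.1 = C :=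
        Maximal.eq_of_le (show Maximal (fun K : Subgroup G => IsCyclic K) N.1 from N.2) hC
          (by rw [hg N]; simpa using h2)
      exact hne (congrArg g (Subtype.ext (hMC.trans hNC.symm)))
    rwa [Finset.card_image_of_injective _ hinj, Finset.card_univ, ← Nat.card_eq_fintype_card,
      Nat.card_coe_set_eq] at hle

/-! ### Multiplicativity over coprime factors and Sylow subgroups. -/

/-- Maximality in a product order is tested one coordinate at a time. This serves both group
isomorphisms (a single factor) and coprime products. -/
theorem numMaxCyclic_congr_orderIso {G : Type*} [Group G] {ι : Type*} [Fintype ι] {H : ι → Type*}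
    [∀ i, Group (H i)] (e : Subgroup G ≃o ∀ i, Subgroup (H i))
    (he : ∀ K : Subgroup G, IsCyclic K ↔ ∀ i, IsCyclic (e K i)) :
    numMaxCyclic G = ∏ i, numMaxCyclic (H i) := by
  classical
  have hmax : ∀ K, Maximal (fun K : Subgroup G => IsCyclic K) K ↔
      ∀ i, Maximal (fun K : Subgroup (H i) => IsCyclic K) (e K i) := by
    intro K
    constructor
    · intro hK i
      refine ⟨(he K).1 hK.1 i, fun N hN hle => ?_⟩
      have h1 : K ≤ e.symm (Function.update (e K) i N) := by
        rw [e.le_symm_apply, Pi.le_def]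
        intro j
        by_cases hj : j = i
        · subst hj; simpa using hle
        · simp [hj]
      have h2 : IsCyclic (e.symm (Function.update (e K) i N)) := by
        rw [he, e.apply_symm_apply]
        intro j
        by_cases hj : j = i
        · subst hj; rwa [Function.update_self]
        · rw [Function.update_of_ne hj]; exact (he K).1 hK.1 j
      have h3 := hK.2 h2 h1
      rw [e.symm_apply_le] at h3
      simpa using h3 i
    · intro hK
      refine ⟨(he K).2 fun i => (hK i).1, fun N hN hle => ?_⟩
      exact e.le_iff_le.1 fun i => (hK i).2 ((he N).1 hN i) (e.le_iff_le.2 hle i)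
  have : Nat.card {K : Subgroup G // Maximal (fun K : Subgroup G => IsCyclic K) K} =
      Nat.card (∀ i, {K : Subgroup (H i) // Maximal (fun K : Subgroup (H i) => IsCyclic K) K}) :=
    Nat.card_congr ((e.toEquiv.subtypeEquiv hmax).trans
      (Equiv.subtypePiEquivPi (p := fun i (K : Subgroup (H i)) =>
        Maximal (fun K : Subgroup (H i) => IsCyclic K) K)))
  rw [Nat.card_pi] at this
  exact this

theorem MulEquiv.numMaxCyclic_eq {G H : Type*} [Group G] [Group H] (e : G ≃* H) :
    numMaxCyclic G = numMaxCyclic H := by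
  have := numMaxCyclic_congr_orderIso (ι := Unit) (H := fun _ => H)
    (e.mapSubgroup.trans (OrderIso.funUnique Unit (Subgroup H)).symm) (fun K : Subgroup G => by
      refine (e.subgroupMap K).isCyclic.trans ?_
      exact ⟨fun h _ => h, fun h => h ()⟩)
  simpa using this

section CoprimeProduct

variable {ι : Type*} [Fintype ι] {H : ι → Type*} [∀ i, Group (H i)]

theorem exists_pow_eq_mulSingle [DecidableEq ι]
    (hco : Pairwise fun i j => (Nat.card (H i)).Coprime (Nat.card (H j)))
    (i : ι) : ∃ n : ℕ, ∀ x : ∀ i, H i, x ^ n = Pi.mulSingle i (x i) := by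
  have hc : (Nat.card (H i)).Coprime (∏ j ∈ Finset.univ.erase i, Nat.card (H j)) :=
    Nat.Coprime.prod_right fun j hj => hco (Finset.ne_of_mem_erase hj).symm
  -- `n` is 1 modulo the order of the `i`-th factor and 0 modulo all the others.
  obtain ⟨n, hn1, hn0⟩ := Nat.chineseRemainder hc 1 0
  refine ⟨n, fun x => funext fun j => ?_⟩
  rw [Pi.pow_apply]
  by_cases hj : j = i
  · subst hj
    rw [Pi.mulSingle_eq_same]
    conv_rhs => rw [← pow_one (x j)]
    exact pow_eq_pow_iff_modEq.2 (hn1.of_dvd (orderOf_dvd_natCard _))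
  · rw [Pi.mulSingle_eq_of_ne hj]
    refine orderOf_dvd_iff_pow_eq_one.1 ((orderOf_dvd_natCard _).trans ?_)
    exact (Finset.dvd_prod_of_mem (fun j => Nat.card (H j)) (by simp [hj])).trans
      (Nat.modEq_zero_iff_dvd.1 hn0)

theorem Subgroup.map_evalMonoidHom_pi {ι : Type*} {H : ι → Type*} [∀ i, Group (H i)]
    (K : ∀ i, Subgroup (H i)) (i : ι) :
    (Subgroup.pi Set.univ K).map (Pi.evalMonoidHom H i) = K i := by
  classical
  ext x
  constructor
  · rintro ⟨y, hy, rfl⟩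
    exact hy i trivial
  · intro hx
    refine ⟨Pi.mulSingle i x, fun j _ => ?_, by simp⟩
    by_cases hj : j = i
    · subst hj; simpa using hx
    · rw [Pi.mulSingle_eq_of_ne hj]; exact (K j).one_mem

theorem Subgroup.pi_map_evalMonoidHom
    (hco : Pairwise fun i j => (Nat.card (H i)).Coprime (Nat.card (H j)))
    (K : Subgroup (∀ i, H i)) :
    Subgroup.pi Set.univ (fun i => K.map (Pi.evalMonoidHom H i)) = K := by
  classical
  apply le_antisymm
  · intro x hx
    refine Subgroup.pi_mem_of_mulSingle_mem x fun i => ?_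
    obtain ⟨y, hy, hyx⟩ := hx i trivial
    obtain ⟨n, hn⟩ := exists_pow_eq_mulSingle hco i
    have : y i = x i := hyx
    rw [← this, ← hn y]
    exact K.pow_mem hy n
  · exact fun x hx i _ => ⟨x, hx, rfl⟩

/-- The subgroups of a product of groups of pairwise coprime orders are the products of
subgroups. -/
def Subgroup.orderIsoPi
    (hco : Pairwise fun i j => (Nat.card (H i)).Coprime (Nat.card (H j))) :
    Subgroup (∀ i, H i) ≃o ∀ i, Subgroup (H i) where
  toFun K i := K.map (Pi.evalMonoidHom H i)
  invFun K := Subgroup.pi Set.univ K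
  left_inv K := Subgroup.pi_map_evalMonoidHom hco K
  right_inv K := funext fun i => Subgroup.map_evalMonoidHom_pi K i
  map_rel_iff' {K L} := by
    refine ⟨fun h => ?_, fun h i => Subgroup.map_mono h⟩
    rw [← Subgroup.pi_map_evalMonoidHom hco K, ← Subgroup.pi_map_evalMonoidHom hco L]
    exact fun x hx i hi => h i (hx i hi)

theorem numMaxCyclic_pi
    (hco : Pairwise fun i j => (Nat.card (H i)).Coprime (Nat.card (H j))) :
    numMaxCyclic (∀ i, H i) = ∏ i, numMaxCyclic (H i) := by
  refine numMaxCyclic_congr_orderIso (Subgroup.orderIsoPi hco)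
    fun K : Subgroup (∀ i, H i) => ⟨fun h i => ?_, fun h => ?_⟩
  · obtain ⟨g, rfl⟩ := IsCyclic.exists_eq_zpowers h
    change IsCyclic ((Subgroup.zpowers g).map (Pi.evalMonoidHom H i))
    rw [MonoidHom.map_zpowers]
    infer_instance
  · choose g hg using fun i => IsCyclic.exists_eq_zpowers (h i)
    have : K = Subgroup.zpowers g := by
      apply (Subgroup.orderIsoPi hco).injective
      funext i
      rw [hg i]
      exact (MonoidHom.map_zpowers (Pi.evalMonoidHom H i) g).symm
    rw [this]
    infer_instance

end CoprimeProduct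

theorem numMaxCyclic_eq_prod_sylow (G : Type*) [CommGroup G] [Finite G]
    (P : (p : ℕ) → Sylow p G) :
    numMaxCyclic G = ∏ p ∈ (Nat.card G).primeFactors, numMaxCyclic (P p) := by
  have hn : ∀ {p : ℕ} [Fact p.Prime] (P : Sylow p G), P.Normal := fun P => inferInstance
  have hp : ∀ p : (Nat.card G).primeFactors, Fact (p : ℕ).Prime :=
    fun p => ⟨Nat.prime_of_mem_primeFactors p.2⟩
  have hu : ∀ p : (Nat.card G).primeFactors, ∀ Q : Sylow p G, Q = P p := fun p Q =>
    letI := Sylow.unique_of_normal (P p) inferInstance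
    Subsingleton.elim _ _
  -- `Sylow.directProductOfNormal` has an inner product over all Sylow `p`-subgroups; here there is
  -- only one.
  let e : ∀ p : (Nat.card G).primeFactors, (∀ Q : Sylow p G, Q) ≃* P p := fun p =>
    letI : Unique (Sylow p G) := ⟨⟨P p⟩, hu p⟩
    MulEquiv.piUnique (fun Q : Sylow p G => Q)
  rw [← (Sylow.directProductOfNormal hn).numMaxCyclic_eq, numMaxCyclic_pi,
    ← Finset.prod_coe_sort (Nat.card G).primeFactors (fun p => numMaxCyclic (P p))]
  · exact Finset.prod_congr rfl fun p _ => (e p).numMaxCyclic_eq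
  · intro p q hpq
    rw [Nat.card_congr (e p).toEquiv, Nat.card_congr (e q).toEquiv]
    exact IsPGroup.coprime_card_of_ne p q (fun h => hpq (Subtype.ext h)) _ _
      (P p).isPGroup' (P q).isPGroup'

/-! ### Cyclic subgroups of `p`-groups. -/

open Subgroup in
theorem IsPGroup.exists_zpowers_eq_zpowers_pow {p : ℕ} [Fact p.Prime] {G : Type*} [Group G]
    [Finite G] (hG : IsPGroup p G) {x c : G} (hx : x ∈ zpowers c) :
    ∃ i : ℕ, zpowers x = zpowers (c ^ p ^ i) := by
  obtain ⟨a, rfl⟩ := mem_powers_iff_mem_zpowers.2 hx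
  obtain ⟨k, hk⟩ := IsPGroup.iff_orderOf.1 hG c
  rcases Nat.eq_zero_or_pos a with rfl | ha
  · exact ⟨k, by rw [← hk, pow_orderOf_eq_one]; simp⟩
  obtain ⟨i, b, hb, rfl⟩ := Nat.exists_eq_pow_mul_and_not_dvd ha.ne' p (Fact.out : p.Prime).ne_one
  refine ⟨i, ?_⟩
  -- The factor `b` is prime to `p`, so raising to the power `b` keeps the order, hence the subgroup
  -- generated.
  simp only [pow_mul]
  refine Subgroup.eq_of_le_of_card_ge (by simp) ?_
  rw [Nat.card_zpowers, Nat.card_zpowers]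
  refine (Nat.Coprime.orderOf_pow ?_).ge
  obtain ⟨l, hl⟩ := IsPGroup.iff_orderOf.1 hG (c ^ p ^ i)
  rw [hl]
  exact Nat.Coprime.pow_left _ (((Fact.out : p.Prime).coprime_iff_not_dvd).2 hb)

theorem IsPGroup.powerGraph_eq_enhancedPowerGraph {p : ℕ} [Fact p.Prime] {G : Type*} [Group G]
    [Finite G] (hG : IsPGroup p G) : powerGraph G = enhancedPowerGraph G := by
  have key : ∀ {x y : G}, Subgroup.zpowers x ≤ Subgroup.zpowers y → ∃ a : ℕ, x = y ^ a := by
    intro x y h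
    obtain ⟨a, ha⟩ := mem_powers_iff_mem_zpowers.2 (h (Subgroup.mem_zpowers x))
    exact ⟨a, ha.symm⟩
  ext x y
  refine and_congr_right fun _ => ⟨?_, ?_⟩
  · rintro (⟨a, rfl⟩ | ⟨a, rfl⟩)
    · exact ⟨Subgroup.zpowers x, inferInstance, by simp, by simp⟩
    · exact ⟨Subgroup.zpowers y, inferInstance, by simp, by simp⟩
  · rintro ⟨C, hC, hx, hy⟩
    obtain ⟨c, rfl⟩ := IsCyclic.exists_eq_zpowers hC
    obtain ⟨i, hi⟩ := hG.exists_zpowers_eq_zpowers_pow hx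
    obtain ⟨j, hj⟩ := hG.exists_zpowers_eq_zpowers_pow hy
    have hle : ∀ {i j : ℕ}, i ≤ j →
        Subgroup.zpowers (c ^ p ^ j) ≤ Subgroup.zpowers (c ^ p ^ i) := by
      intro i j hij
      obtain ⟨k, rfl⟩ := Nat.exists_eq_add_of_le hij
      rw [pow_add, pow_mul]
      simp
    rcases le_total i j with h | h
    · exact Or.inl (key (by rw [hi, hj]; exact hle h))
    · exact Or.inr (key (by rw [hi, hj]; exact hle h))

theorem IsPGroup.maximal_isCyclic_zpowers_iff {p : ℕ} [Fact p.Prime] {G : Type*} [Group G]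
    [Finite G] [Nontrivial G] (hG : IsPGroup p G) (g : G) :
    Maximal (fun K : Subgroup G => IsCyclic K) (Subgroup.zpowers g) ↔ ¬ ∃ h : G, h ^ p = g := by
  have hp : p.Prime := Fact.out
  constructor
  · rintro hmax ⟨h, rfl⟩
    have heq : Subgroup.zpowers (h ^ p) = Subgroup.zpowers h :=
      hmax.eq_of_le (inferInstance : IsCyclic (Subgroup.zpowers h)) (by simp)
    -- If `h ≠ 1`, then `h ^ p` has strictly smaller order than `h`. The case `h = 1` would make the
    -- trivial subgroup maximal.
    have hh : h = 1 := by
      have hcard := congrArg (fun K : Subgroup G => Nat.card K) heq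
      simp only [Nat.card_zpowers] at hcard
      by_contra hne
      obtain ⟨k, hk⟩ := IsPGroup.iff_orderOf.1 hG h
      have hk0 : k ≠ 0 := by
        rintro rfl
        exact hne (orderOf_eq_one_iff.1 (by simpa using hk))
      have hdvd : p ∣ orderOf h := hk ▸ dvd_pow_self p hk0
      rw [orderOf_pow_of_dvd hp.ne_zero hdvd] at hcard
      exact (Nat.div_lt_self (orderOf_pos h) hp.one_lt).ne hcard
    subst hh
    obtain ⟨x, hx⟩ := exists_ne (1 : G)
    have := hmax.eq_of_le (inferInstance : IsCyclic (Subgroup.zpowers x)) (by simp)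
    rw [one_pow, Subgroup.zpowers_one_eq_bot, eq_comm, Subgroup.zpowers_eq_bot] at this
    exact hx this
  · intro hg
    refine ⟨inferInstance, fun K hK hle => ?_⟩
    obtain ⟨c, rfl⟩ := IsCyclic.exists_eq_zpowers hK
    obtain ⟨i, hi⟩ := hG.exists_zpowers_eq_zpowers_pow (hle (Subgroup.mem_zpowers g))
    rcases i with _ | i
    · simp [hi]
    · exfalso
      obtain ⟨a, ha⟩ := mem_powers_iff_mem_zpowers.2 (hi ▸ Subgroup.mem_zpowers g)
      refine hg ⟨(c ^ p ^ i) ^ a, ?_⟩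
      change (c ^ p ^ (i + 1)) ^ a = g at ha
      rw [← ha, ← pow_mul, ← pow_mul, ← pow_mul, pow_succ, mul_assoc, mul_comm a p]

/-! ### Counting maximal cyclic subgroups by torsion. -/

theorem card_filter_zpowers_eq {G : Type*} [Group G] [Fintype G] (g : G)
    [DecidablePred fun x : G => Subgroup.zpowers x = Subgroup.zpowers g] :
    (Finset.univ.filter fun x : G => Subgroup.zpowers x = Subgroup.zpowers g).card =
      (orderOf g).totient := by
  classical
  rw [← IsCyclic.card_orderOf_eq_totient (α := Subgroup.zpowers g)
    (d := orderOf g) (by rw [Fintype.card_zpowers])]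
  symm
  refine Finset.card_bij (fun x _ => x.1) ?_ (fun x _ y _ h => Subtype.ext h) ?_
  · intro x hx
    simp only [Finset.mem_filter, Finset.mem_univ, true_and] at hx ⊢
    refine Subgroup.eq_of_le_of_card_ge (by simp) ?_
    rw [Nat.card_zpowers, Nat.card_zpowers, Subgroup.orderOf_coe, hx]
  · intro x hx
    simp only [Finset.mem_filter, Finset.mem_univ, true_and] at hx
    refine ⟨⟨x, hx ▸ Subgroup.mem_zpowers x⟩, ?_, rfl⟩
    simp only [Finset.mem_filter, Finset.mem_univ, true_and, Subgroup.orderOf_mk]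
    rw [← Nat.card_zpowers, hx, Nat.card_zpowers]

/-- The maximal cyclic subgroups of a finite group, counted through their generators. -/
theorem numMaxCyclic_eq_sum_inv_totient (G : Type*) [Group G] [Fintype G]
    [DecidablePred fun g : G => Maximal (fun K : Subgroup G => IsCyclic K) (Subgroup.zpowers g)] :
    (numMaxCyclic G : ℚ) = ∑ g : G with
      Maximal (fun K : Subgroup G => IsCyclic K) (Subgroup.zpowers g),
      ((orderOf g).totient : ℚ)⁻¹ := by
  classical
  have hfin : {H : Subgroup G | Maximal (fun K : Subgroup G => IsCyclic K) H}.Finite :=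
    Set.toFinite _
  rw [numMaxCyclic, Set.ncard_eq_toFinset_card _ hfin, ← Finset.sum_fiberwise_of_maps_to
    (t := hfin.toFinset) (g := fun g => Subgroup.zpowers g) (by simp), Finset.card_eq_sum_ones,
    Nat.cast_sum]
  refine Finset.sum_congr rfl fun H hH => ?_
  rw [Set.Finite.mem_toFinset] at hH
  obtain ⟨g, rfl⟩ := IsCyclic.exists_eq_zpowers hH.1
  have hset : (Finset.univ.filter fun x : G => Maximal (fun K : Subgroup G => IsCyclic K)
      (Subgroup.zpowers x)).filter (fun x => Subgroup.zpowers x = Subgroup.zpowers g) =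
      Finset.univ.filter fun x : G => Subgroup.zpowers x = Subgroup.zpowers g := by
    ext x
    simp only [Finset.mem_filter, Finset.mem_univ, true_and, and_iff_right_iff_imp]
    intro h
    rw [h]
    exact hH
  rw [hset, Finset.sum_congr rfl (g := fun _ => ((orderOf g).totient : ℚ)⁻¹), Finset.sum_const,
    card_filter_zpowers_eq, nsmul_eq_mul, mul_inv_cancel₀]
  · simp
  · exact_mod_cast (Nat.totient_pos.2 (orderOf_pos g)).ne'
  · intro x hx
    rw [Finset.mem_filter] at hx
    rw [← Nat.card_zpowers, hx.2, Nat.card_zpowers]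

/-- The map `x ↦ x ^ a` sends the `a * b`-torsion onto the `a`-th powers in the `b`-torsion, with
kernel the `a`-torsion. -/
theorem card_ker_pow_mul_range_inf (G : Type*) [CommGroup G] (a b : ℕ) :
    Nat.card (powMonoidHom a : G →* G).ker *
      Nat.card ((powMonoidHom a : G →* G).range ⊓ (powMonoidHom b : G →* G).ker : Subgroup G) =
    Nat.card (powMonoidHom (a * b) : G →* G).ker := by
  have hle : (powMonoidHom a : G →* G).ker ≤ (powMonoidHom (a * b) : G →* G).ker := by
    intro x hx
    simp only [MonoidHom.mem_ker, powMonoidHom_apply] at hx ⊢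
    rw [pow_mul, hx, one_pow]
  have hmap : (powMonoidHom (a * b) : G →* G).ker.map (powMonoidHom a) =
      (powMonoidHom a : G →* G).range ⊓ (powMonoidHom b : G →* G).ker := by
    ext y
    constructor
    · rintro ⟨x, hx, rfl⟩
      refine ⟨⟨x, rfl⟩, ?_⟩
      simpa [MonoidHom.mem_ker, pow_mul] using hx
    · rintro ⟨⟨x, rfl⟩, hx⟩
      refine ⟨x, ?_, rfl⟩
      simpa [MonoidHom.mem_ker, pow_mul] using hx
  rw [← hmap, ← Subgroup.relIndex_ker, ← Subgroup.relIndex_bot_left,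
    ← Subgroup.relIndex_bot_left (powMonoidHom (a * b) : G →* G).ker]
  exact Subgroup.relIndex_mul_relIndex _ _ _ bot_le hle

theorem numMaxCyclic_eq_sum_card_torsion {p : ℕ} [Fact p.Prime] {G : Type*} [CommGroup G]
    [Fintype G] (L : ℕ) (hL : ∀ g : G, g ^ p ^ L = 1) [Nontrivial G]
    (A : ℕ → ℚ) (hA : ∀ e, A e = Nat.card (powMonoidHom (p ^ e) : G →* G).ker) :
    (numMaxCyclic G : ℚ) = ∑ e ∈ Finset.range L,
      ((A (e + 1) - A e) - (A (e + 2) - A (e + 1)) / A 1) / (p ^ e * (p - 1)) := by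
  classical
  have hp : p.Prime := Fact.out
  have hG : IsPGroup p G := fun g => ⟨L, hL g⟩
  rw [numMaxCyclic_eq_sum_inv_totient]
  simp_rw [hG.maximal_isCyclic_zpowers_iff]
  set f : ℕ → ℕ := fun e => (Finset.univ.filter fun g : G => (¬ ∃ h : G, h ^ p = g) ∧
    g ^ p ^ e = 1).card with hf
  have hA1 : A 1 ≠ 0 := by
    rw [hA]
    exact_mod_cast Nat.card_pos.ne'
  have hfA : ∀ e, (f e : ℚ) = A e - A (e + 1) / A 1 := by
    intro e
    have h1 := card_ker_pow_mul_range_inf G p (p ^ e)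
    have h2 : Nat.card (powMonoidHom (p ^ e) : G →* G).ker = f e +
        Nat.card ((powMonoidHom p : G →* G).range ⊓
          (powMonoidHom (p ^ e) : G →* G).ker : Subgroup G) := by
      rw [Nat.subtype_card (Finset.univ.filter fun g : G => g ^ p ^ e = 1)
        (by simp [MonoidHom.mem_ker]),
        Nat.subtype_card (Finset.univ.filter fun g : G => (∃ h : G, h ^ p = g) ∧ g ^ p ^ e = 1)
        (by simp [MonoidHom.mem_ker]), hf, add_comm,
        ← Finset.card_filter_add_card_filter_not (fun g : G => ∃ h : G, h ^ p = g)]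
      simp only [Finset.filter_filter, and_comm]
    have h3 := hA 1
    rw [pow_one] at h3
    rw [eq_sub_iff_add_eq, hA e, h2, Nat.cast_add, hA (e + 1), pow_succ', ← h1, h3, Nat.cast_mul,
      mul_div_cancel_left₀ _ (h3 ▸ hA1)]
  have hord : ∀ g : G, (¬ ∃ h : G, h ^ p = g) → ∃ k < L, orderOf g = p ^ (k + 1) := by
    intro g hg
    obtain ⟨k, hkL, hk⟩ := (Nat.dvd_prime_pow hp).1 (orderOf_dvd_of_pow_eq_one (hL g))
    rcases k with _ | k
    · rw [pow_zero, orderOf_eq_one_iff] at hk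
      exact absurd ⟨1, by rw [hk, one_pow]⟩ hg
    · exact ⟨k, hkL, hk⟩
  -- Index `e` collects the elements of order `p ^ (e + 1)`. Order 1 does not occur since `1 = 1 ^
  -- p`, so the subtraction never truncates.
  rw [← Finset.sum_fiberwise_of_maps_to (t := Finset.range L)
    (g := fun g => Nat.log p (orderOf g) - 1)]
  · refine Finset.sum_congr rfl fun e _ => ?_
    have hset : (Finset.univ.filter fun g : G => ¬ ∃ h : G, h ^ p = g).filter
        (fun g => Nat.log p (orderOf g) - 1 = e) =
        (Finset.univ.filter fun g : G => (¬ ∃ h : G, h ^ p = g) ∧ g ^ p ^ (e + 1) = 1) \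
        (Finset.univ.filter fun g : G => (¬ ∃ h : G, h ^ p = g) ∧ g ^ p ^ e = 1) := by
      ext g
      by_cases hg : ∃ h : G, h ^ p = g
      · simp [hg]
      · obtain ⟨k, -, hk⟩ := hord g hg
        simp only [Finset.mem_filter, Finset.mem_univ, true_and, Finset.mem_sdiff, hg,
          not_false_eq_true, ← orderOf_dvd_iff_pow_eq_one, hk, Nat.log_pow hp.one_lt,
          Nat.pow_dvd_pow_iff_le_right hp.one_lt]
        omega
    have hsub : (Finset.univ.filter fun g : G => (¬ ∃ h : G, h ^ p = g) ∧ g ^ p ^ e = 1) ⊆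
        Finset.univ.filter fun g : G => (¬ ∃ h : G, h ^ p = g) ∧ g ^ p ^ (e + 1) = 1 := by
      intro g
      simp only [Finset.mem_filter, Finset.mem_univ, true_and]
      exact fun h => ⟨h.1, by rw [pow_succ, pow_mul, h.2, one_pow]⟩
    rw [Finset.sum_congr rfl (g := fun _ => ((p : ℚ) ^ e * (p - 1))⁻¹), Finset.sum_const, hset,
      nsmul_eq_mul, Finset.cast_card_sdiff hsub]
    · change ((f (e + 1) : ℚ) - f e) * _ = _
      rw [hfA, hfA, div_eq_mul_inv _ ((p : ℚ) ^ e * (p - 1))]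
      ring
    · intro g hg
      simp only [Finset.mem_filter, Finset.mem_univ, true_and] at hg
      obtain ⟨k, -, hk⟩ := hord g hg.1
      have hke : k = e := by
        have := hg.2
        rwa [hk, Nat.log_pow hp.one_lt] at this
      rw [hk, hke, Nat.totient_prime_pow_succ hp, Nat.cast_mul, Nat.cast_sub hp.one_le]
      simp
  · intro g hg
    simp only [Finset.mem_filter, Finset.mem_univ, true_and] at hg
    obtain ⟨k, hkL, hk⟩ := hord g hg
    rw [hk, Nat.log_pow hp.one_lt, Finset.mem_range]
    exact hkL

/-! ### Torsion of the standard `p`-group. -/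

/-- The exponent of `p` in the number of elements `x` of `StdPGroup p s α m` with
`x ^ p ^ e = 1`. -/
def torsionExp (s : ℕ) (α m : ℕ → ℕ) (e : ℕ) : ℕ := ∑ i ∈ Finset.Icc 1 s, m i * min (α i) e

theorem Nat.card_pi_nsmul_eq_zero {ι : Type*} [Fintype ι] (M : ι → Type*)
    [∀ i, AddCommMonoid (M i)] (n : ℕ) :
    Nat.card {x : ∀ i, M i // n • x = 0} = ∏ i, Nat.card {x : M i // n • x = 0} := by
  rw [← Nat.card_pi]
  refine Nat.card_congr (Equiv.trans (Equiv.subtypeEquivRight fun x => ?_)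
    (Equiv.subtypePiEquivPi (p := fun i (x : M i) => n • x = 0)))
  simp [funext_iff]

theorem ZMod.card_nsmul_eq_zero {n : ℕ} (hn : n ≠ 0) (d : ℕ) :
    Nat.card {x : ZMod n // d • x = 0} = n.gcd d := by
  have : NeZero n := ⟨hn⟩
  have h := IsAddCyclic.card_nsmulAddMonoidHom_ker (ZMod n) d
  rw [Nat.card_zmod] at h
  rw [← h]
  exact Nat.card_congr (Equiv.subtypeEquivRight fun x => by simp [AddMonoidHom.mem_ker])

theorem StdPGroup.card_ker_pow {p : ℕ} (hp : p.Prime) (s : ℕ) (α m : ℕ → ℕ) (e : ℕ) :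
    Nat.card (powMonoidHom (p ^ e) : StdPGroup p s α m →* StdPGroup p s α m).ker =
      p ^ torsionExp s α m e := by
  have h : Nat.card (powMonoidHom (p ^ e) : StdPGroup p s α m →* StdPGroup p s α m).ker =
      Nat.card {x : (i : Finset.Icc 1 s) → Fin (m i) → ZMod (p ^ α i) // p ^ e • x = 0} :=
    Nat.card_congr (Equiv.subtypeEquiv Multiplicative.toAdd fun x => Iff.rfl)
  rw [h, Nat.card_pi_nsmul_eq_zero]
  simp_rw [Nat.card_pi_nsmul_eq_zero, ZMod.card_nsmul_eq_zero (pow_ne_zero _ hp.ne_zero)]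
  rw [torsionExp, ← Finset.prod_pow_eq_pow_sum,
    ← Finset.prod_coe_sort (Finset.Icc 1 s) (fun i => p ^ (m i * min (α i) e))]
  refine Finset.prod_congr rfl fun i _ => ?_
  have hg : (p ^ α i).gcd (p ^ e) = p ^ min (α i) e := by
    rcases le_total (α i) e with h | h
    · rw [min_eq_left h, Nat.gcd_eq_left (pow_dvd_pow p h)]
    · rw [min_eq_right h, Nat.gcd_eq_right (pow_dvd_pow p h)]
  rw [Finset.prod_const, Finset.card_univ, Fintype.card_fin, hg, ← pow_mul, mul_comm]

/-! ### Evaluation of the closed formula. -/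

section Formula

variable {p s : ℕ} {α m : ℕ → ℕ}

theorem torsionExp_zero : torsionExp s α m 0 = 0 := by simp [torsionExp]

theorem IsTypeData.torsionExp_one (h : IsTypeData s α m) : torsionExp s α m 1 = rSum m s :=
  Finset.sum_congr rfl fun i hi => by
    have := h.α_pos i (by simpa using hi)
    rw [min_eq_right this, mul_one]

theorem IsTypeData.le_one (h : IsTypeData s α m) {i : ℕ} (hi : i ∈ Set.Icc 1 s) : α i ≤ α 1 :=
  h.strictAnti.antitoneOn ⟨le_rfl, h.one_le⟩ hi hi.1

theorem IsTypeData.torsionExp_of_le (h : IsTypeData s α m) {e : ℕ} (he : α 1 ≤ e) :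
    torsionExp s α m e = ∑ i ∈ Finset.Icc 1 s, m i * α i :=
  Finset.sum_congr rfl fun i hi => by
    rw [min_eq_left ((h.le_one (by simpa using hi)).trans he)]

/-- For such `β`, `min (α i) β` is `β` when `i ≤ j` and `α i` afterwards. The additive form avoids
truncated subtraction. -/
theorem IsTypeData.torsionExp_add (h : IsTypeData s α m) {j β : ℕ} (hj : j ∈ Set.Icc 1 s)
    (hβ : β ≤ α j) (hβ' : ∀ i ∈ Set.Ioc j s, α i ≤ β) :
    torsionExp s α m β + ∑ i ∈ Finset.Icc 1 j, m i * α i =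
      rSum m j * β + ∑ i ∈ Finset.Icc 1 s, m i * α i := by
  have hsum : ∀ f : ℕ → ℕ, ∑ i ∈ Finset.Icc 1 j, f i =
      ∑ i ∈ Finset.Icc 1 s, if i ≤ j then f i else 0 := by
    intro f
    rw [← Finset.sum_filter]
    refine Finset.sum_congr ?_ fun _ _ => rfl
    ext i
    have := hj.2
    simp only [Finset.mem_Icc, Finset.mem_filter]
    omega
  rw [rSum, torsionExp, Finset.sum_mul, hsum, hsum, ← Finset.sum_add_distrib,
    ← Finset.sum_add_distrib]
  refine Finset.sum_congr rfl fun i hi => ?_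
  rw [Finset.mem_Icc] at hi
  split_ifs with hij
  · rw [min_eq_right (hβ.trans (h.strictAnti.antitoneOn hi hj hij))]
  · rw [min_eq_left (hβ' i ⟨not_le.1 hij, hi.2⟩), add_comm]

theorem IsTypeData.torsionExp_succ (h : IsTypeData s α m) {j β : ℕ} (hj : j ∈ Set.Icc 1 s)
    (hβ : β < α j) (hβ' : ∀ i ∈ Set.Ioc j s, α i ≤ β) :
    torsionExp s α m (β + 1) = torsionExp s α m β + rSum m j := by
  have h1 := h.torsionExp_add hj hβ.le hβ'
  have h2 := h.torsionExp_add hj hβ fun i hi => (hβ' i hi).trans (Nat.le_succ β)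
  rw [Nat.succ_eq_add_one, mul_add, mul_one] at h2
  omega

theorem IsTypeData.one_le_rSum (h : IsTypeData s α m) {j : ℕ} (hj : 1 ≤ j) : 1 ≤ rSum m j := by
  have h1 : rSum m 1 = m 1 := by simp [rSum]
  have := h.m_pos 1 ⟨le_rfl, h.one_le⟩
  have := rSum_mono m hj
  omega

theorem IsTypeData.le_of_mem_Ioc (h : IsTypeData s α m) {j i : ℕ} (hj : 1 ≤ j)
    (hi : i ∈ Set.Ioc j s) :
    α i ≤ α (j + 1) :=
  h.strictAnti.antitoneOn ⟨by omega, (Nat.succ_le_of_lt hi.1).trans hi.2⟩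
    ⟨hj.trans hi.1.le, hi.2⟩ hi.1

theorem IsTypeData.nProd_mul_div (hp : p.Prime) (h : IsTypeData s α m) {j β : ℕ}
    (hj : j ∈ Set.Icc 1 s) (hβ : β ≤ α j) (hβ' : ∀ i ∈ Set.Ioc j s, α i ≤ β) :
    (nProd p α m s : ℚ) * ((p : ℚ) ^ ((rSum m j - 1) * β) / (nProd p α m j : ℚ)) =
      (p : ℚ) ^ torsionExp s α m β / (p : ℚ) ^ β := by
  have hp0 : (p : ℚ) ≠ 0 := by exact_mod_cast hp.ne_zero
  have hr := h.one_le_rSum hj.1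
  have := h.torsionExp_add hj hβ hβ'
  simp only [nProd, Nat.cast_pow]
  rw [← mul_div_assoc, div_eq_div_iff (pow_ne_zero _ hp0) (pow_ne_zero _ hp0), ← pow_add,
    ← pow_add, ← pow_add, this]
  congr 1
  obtain ⟨r, hr'⟩ := Nat.exists_eq_add_of_le hr
  rw [hr', Nat.add_sub_cancel_left]
  ring

/-- `p ^ (-a) A_a + ∑_{a ≤ β < L} p ^ (-β) (A_{β + 1} - A_β)`, where `A_β` stands for the
number of elements of order dividing `p ^ β`. -/
def torsionSum (p L : ℕ) (A : ℕ → ℚ) (a : ℕ) : ℚ :=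
  A a / (p : ℚ) ^ a + ∑ β ∈ Finset.Ico a L, (A (β + 1) - A β) / (p : ℚ) ^ β

theorem torsionSum_sub (hp : p.Prime) {L : ℕ} (A : ℕ → ℚ) {a b : ℕ} (hab : a ≤ b) (hb : b ≤ L) :
    torsionSum p L A a - torsionSum p L A b =
      ((p : ℚ) - 1) / p * ∑ β ∈ Finset.Ico a b, A (β + 1) / (p : ℚ) ^ β := by
  have hp0 : (p : ℚ) ≠ 0 := by exact_mod_cast hp.ne_zero
  induction b, hab using Nat.le_induction with
  | base => simp
  | succ b hab ih =>
    have ih := ih (by omega)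
    have hstep : torsionSum p L A b - torsionSum p L A (b + 1) =
        ((p : ℚ) - 1) / p * (A (b + 1) / (p : ℚ) ^ b) := by
      rw [torsionSum, torsionSum, Finset.sum_eq_sum_Ico_succ_bot (by omega : b < L)]
      field_simp
      ring
    rw [Finset.sum_Ico_succ_top hab, mul_add, ← ih, ← hstep]
    ring

theorem muTerm_succ {k : ℕ} (hk : 1 ≤ k) : muTerm p α m (k + 1) = muTerm p α m k +
    ((p : ℚ) ^ rSum m k - 1) / (nProd p α m k : ℚ) *
      ∑ β ∈ Finset.Ico (α (k + 1)) (α k), (p : ℚ) ^ ((rSum m k - 1) * β) := by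
  rw [muTerm, if_pos (by omega), Nat.add_sub_cancel]
  obtain ⟨k, rfl⟩ := Nat.exists_eq_add_of_le' hk
  rw [Finset.sum_Icc_succ_top (by omega), muTerm]
  congr 1
  split_ifs with h
  · rw [Nat.add_sub_cancel]
  · have : k = 0 := by omega
    subst this
    simp

/-- Since `A (β + 1) = p ^ rSum m j * A β` for `α (j + 1) ≤ β < α j`, the `β`-term of `μ_k` times
`n` is `(A (β + 1) - A β) / p ^ β`. -/
theorem IsTypeData.nProd_mul_add_muTerm (hp : p.Prime) (h : IsTypeData s α m) {k : ℕ} (hk : 1 ≤ k)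
    (hks : k ≤ s) :
    (nProd p α m s : ℚ) * ((p : ℚ) ^ ((rSum m k - 1) * α k) / (nProd p α m k : ℚ) +
      muTerm p α m k) =
    torsionSum p (α 1) (fun e => (p : ℚ) ^ torsionExp s α m e) (α k) := by
  have hmain : ∀ k, 1 ≤ k → k ≤ s → (nProd p α m s : ℚ) * ((p : ℚ) ^ ((rSum m k - 1) * α k) /
      (nProd p α m k : ℚ)) = (p : ℚ) ^ torsionExp s α m (α k) / (p : ℚ) ^ α k := fun k hk hks =>
    h.nProd_mul_div hp ⟨hk, hks⟩ le_rfl fun i hi =>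
      h.strictAnti.antitoneOn ⟨hk, hks⟩ ⟨hk.trans hi.1.le, hi.2⟩ hi.1.le
  rw [mul_add, hmain k hk hks, torsionSum]
  congr 1
  induction k, hk using Nat.le_induction with
  | base => simp [muTerm]
  | succ k hk ih =>
    have hks' : k ≤ s := by omega
    have hlt : α (k + 1) < α k := h.strictAnti ⟨hk, hks'⟩ ⟨by omega, hks⟩ (Nat.lt_succ_self k)
    rw [muTerm_succ hk, mul_add, ih hks',
      ← Finset.sum_Ico_consecutive _ hlt.le (h.le_one ⟨hk, hks'⟩), add_comm, Finset.mul_sum,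
      Finset.mul_sum]
    congr 1
    refine Finset.sum_congr rfl fun β hβ => ?_
    rw [Finset.mem_Ico] at hβ
    have hβ' : ∀ i ∈ Set.Ioc k s, α i ≤ β := fun i hi => (h.le_of_mem_Ioc hk hi).trans hβ.1
    have h1 := h.nProd_mul_div hp ⟨hk, hks'⟩ hβ.2.le hβ'
    rw [h.torsionExp_succ ⟨hk, hks'⟩ hβ.2 hβ', pow_add]
    calc _ = ((p : ℚ) ^ rSum m k - 1) * ((nProd p α m s : ℚ) *
          ((p : ℚ) ^ ((rSum m k - 1) * β) / (nProd p α m k : ℚ))) := by ring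
      _ = _ := by rw [h1]; ring

theorem sum_Icc_rSum_succ (f : ℕ → ℚ) (j : ℕ) :
    ∑ t ∈ Finset.Icc 1 (rSum m (j + 1)), f t =
      ∑ t ∈ Finset.Icc 1 (rSum m j), f t + ∑ t ∈ Finset.Ioc (rSum m j) (rSum m (j + 1)), f t := by
  -- On `ℕ`, `Ioc 0 b` is definitionally `Icc 1 b`.
  have := Finset.sum_Ioc_consecutive f (Nat.zero_le _) (rSum_mono m (Nat.le_succ j))
  exact this.symm

theorem sum_Ioc_inv_pow (hp : p.Prime) {a b : ℕ} (hab : a ≤ b) :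
    ∑ t ∈ Finset.Ioc a b, ((p : ℚ) ^ (t - 1))⁻¹ =
      (p : ℚ) / (p - 1) * (((p : ℚ) ^ a)⁻¹ - ((p : ℚ) ^ b)⁻¹) := by
  have hp0 : (p : ℚ) ≠ 0 := by exact_mod_cast hp.ne_zero
  have hp1 : (p : ℚ) - 1 ≠ 0 := sub_ne_zero.2 (by exact_mod_cast hp.ne_one)
  induction b, hab using Nat.le_induction with
  | base => simp
  | succ b hab ih =>
    rw [Finset.sum_Ioc_succ_top hab, ih, Nat.add_sub_cancel]
    field_simp
    ring

theorem IsTypeData.sum_block (hp : p.Prime) (h : IsTypeData s α m) {j : ℕ} (hj : j + 1 ≤ s) :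
    ∑ t ∈ Finset.Ioc (rSum m j) (rSum m (j + 1)), (nProd p α m s : ℚ) / (p : ℚ) ^ (t - 1) *
      ((p : ℚ) ^ ((rSum m (blockIndex m t) - 1) * α (blockIndex m t)) /
          (nProd p α m (blockIndex m t) : ℚ) + muTerm p α m (blockIndex m t)) =
    (p : ℚ) / (p - 1) * (((p : ℚ) ^ rSum m j)⁻¹ - ((p : ℚ) ^ rSum m (j + 1))⁻¹) *
      torsionSum p (α 1) (fun e => (p : ℚ) ^ torsionExp s α m e) (α (j + 1)) := by
  rw [← sum_Ioc_inv_pow hp (rSum_mono m (Nat.le_succ j)), Finset.sum_mul]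
  refine Finset.sum_congr rfl fun t ht => ?_
  rw [Finset.mem_Ioc] at ht
  have hb : blockIndex m t = j + 1 :=
    (blockIndex_eq_iff m (by omega) (ht.2.trans (rSum_mono m hj)) (j + 1)).2
      ⟨⟨by omega, hj⟩, by simpa using ht.1, ht.2⟩
  rw [hb, ← h.nProd_mul_add_muTerm hp (by omega) hj]
  ring

theorem IsTypeData.torsionSum_sub_block (hp : p.Prime) (h : IsTypeData s α m) {j a : ℕ}
    (hj : j ∈ Set.Icc 1 s) (ha : a ≤ α j) (ha' : ∀ i ∈ Set.Ioc j s, α i ≤ a) :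
    (p : ℚ) / (p - 1) * ((p : ℚ) ^ rSum m j)⁻¹ *
      (torsionSum p (α 1) (fun e => (p : ℚ) ^ torsionExp s α m e) a -
        torsionSum p (α 1) (fun e => (p : ℚ) ^ torsionExp s α m e) (α j)) =
    ∑ β ∈ Finset.Ico a (α j), (p : ℚ) ^ torsionExp s α m β / (p : ℚ) ^ β := by
  have hp0 : (p : ℚ) ≠ 0 := by exact_mod_cast hp.ne_zero
  have hp1 : (p : ℚ) - 1 ≠ 0 := sub_ne_zero.2 (by exact_mod_cast hp.ne_one)
  rw [torsionSum_sub hp _ ha (h.le_one hj), Finset.mul_sum, Finset.mul_sum]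
  refine Finset.sum_congr rfl fun β hβ => ?_
  rw [Finset.mem_Ico] at hβ
  rw [h.torsionExp_succ hj hβ.2 fun i hi => (ha' i hi).trans hβ.1, pow_add]
  field_simp

/-- Summation by parts over the blocks: the differences of `torsionSum` between consecutive `α j`
become the final sum over `β`. -/
theorem IsTypeData.indepFormula_eq (hp : p.Prime) (h : IsTypeData s α m) :
    indepFormula p s α m = (p : ℚ) / (p - 1) *
      (torsionSum p (α 1) (fun e => (p : ℚ) ^ torsionExp s α m e) (α 1) - ((p : ℚ) ^ rSum m s)⁻¹ *
        torsionSum p (α 1) (fun e => (p : ℚ) ^ torsionExp s α m e) 0) +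
      ∑ β ∈ Finset.range (α 1), (p : ℚ) ^ torsionExp s α m β / (p : ℚ) ^ β := by
  set g := torsionSum p (α 1) (fun e => (p : ℚ) ^ torsionExp s α m e) with hg
  have key : ∀ j, 1 ≤ j → j ≤ s → ∑ t ∈ Finset.Icc 1 (rSum m j),
      (nProd p α m s : ℚ) / (p : ℚ) ^ (t - 1) *
      ((p : ℚ) ^ ((rSum m (blockIndex m t) - 1) * α (blockIndex m t)) /
          (nProd p α m (blockIndex m t) : ℚ) + muTerm p α m (blockIndex m t)) =
      (p : ℚ) / (p - 1) * (g (α 1) - ((p : ℚ) ^ rSum m j)⁻¹ * g (α j)) +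
        ∑ β ∈ Finset.Ico (α j) (α 1), (p : ℚ) ^ torsionExp s α m β / (p : ℚ) ^ β := by
    intro j hj
    induction j, hj using Nat.le_induction with
    | base =>
      intro hs
      rw [sum_Icc_rSum_succ, h.sum_block hp hs]
      simp [rSum]
      ring
    | succ j hj ih =>
      intro hs
      have hjs : j ≤ s := by omega
      have hlt : α (j + 1) < α j := h.strictAnti ⟨hj, hjs⟩ ⟨by omega, hs⟩ (Nat.lt_succ_self j)
      rw [sum_Icc_rSum_succ, h.sum_block hp hs, ih hjs,
        ← Finset.sum_Ico_consecutive _ hlt.le (h.le_one ⟨hj, hjs⟩),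
        ← h.torsionSum_sub_block hp ⟨hj, hjs⟩ hlt.le fun i hi => h.le_of_mem_Ioc hj hi]
      ring
  have hs : s ∈ Set.Icc 1 s := ⟨h.one_le, le_rfl⟩
  -- The remaining range `0 ≤ β < α s` is treated as a last block, with 0 in the role of `α (s +
  -- 1)`.
  rw [indepFormula, key s h.one_le le_rfl, Finset.range_eq_Ico,
    ← Finset.sum_Ico_consecutive _ (Nat.zero_le (α s)) (h.le_one hs),
    ← h.torsionSum_sub_block hp hs (Nat.zero_le _) fun i hi =>
      absurd (hi.1.trans_le hi.2) (lt_irrefl _)]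
  ring

theorem sum_range_eq_torsionSum (hp : p.Prime) (A : ℕ → ℚ) {L : ℕ} (hA0 : A 0 = 1)
    (hA1 : A 1 ≠ 0) (hAL : A (L + 1) = A L) :
    ∑ e ∈ Finset.range L,
      ((A (e + 1) - A e) - (A (e + 2) - A (e + 1)) / A 1) / (p ^ e * (p - 1)) =
    (p : ℚ) / (p - 1) * (torsionSum p L A L - (A 1)⁻¹ * torsionSum p L A 0) +
      ∑ β ∈ Finset.range L, A β / (p : ℚ) ^ β := by
  have hp0 : (p : ℚ) ≠ 0 := by exact_mod_cast hp.ne_zero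
  have hp1 : (p : ℚ) - 1 ≠ 0 := sub_ne_zero.2 (by exact_mod_cast hp.ne_one)
  have h1 : ∀ N, ∑ e ∈ Finset.range N, (A (e + 1) - A e) / (p : ℚ) ^ e =
      p * (A N / (p : ℚ) ^ N - 1) + (p - 1) * ∑ β ∈ Finset.range N, A β / (p : ℚ) ^ β := by
    intro N
    induction N with
    | zero => simp [hA0]
    | succ N ih =>
      rw [Finset.sum_range_succ, ih, Finset.sum_range_succ]
      field_simp
      ring
  -- An index shift, which brings out the factor `p`; the extra top term vanishes by `hAL`.
  have h2 : ∑ e ∈ Finset.range L, (A (e + 2) - A (e + 1)) / (p : ℚ) ^ e =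
      p * (torsionSum p L A 0 - A 1) := by
    have h3 : ∀ N, ∑ e ∈ Finset.range N, (A (e + 2) - A (e + 1)) / (p : ℚ) ^ e =
        p * (∑ e ∈ Finset.range (N + 1), (A (e + 1) - A e) / (p : ℚ) ^ e - (A 1 - A 0)) := by
      intro N
      induction N with
      | zero => simp
      | succ N ih =>
        rw [Finset.sum_range_succ, ih, Finset.sum_range_succ _ (N + 1)]
        field_simp
        ring
    rw [h3, Finset.sum_range_succ, hAL, torsionSum, Nat.Ico_zero_eq_range, sub_self,
      zero_div, add_zero, pow_zero, div_one]
    ring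
  have hsplit : ∑ e ∈ Finset.range L,
      ((A (e + 1) - A e) - (A (e + 2) - A (e + 1)) / A 1) / ((p : ℚ) ^ e * (p - 1)) =
      (∑ e ∈ Finset.range L, (A (e + 1) - A e) / (p : ℚ) ^ e -
        (A 1)⁻¹ * ∑ e ∈ Finset.range L, (A (e + 2) - A (e + 1)) / (p : ℚ) ^ e) / (p - 1) := by
    rw [Finset.mul_sum, ← Finset.sum_sub_distrib, Finset.sum_div]
    refine Finset.sum_congr rfl fun e _ => ?_
    field_simp
  have h3 : torsionSum p L A L = A L / (p : ℚ) ^ L := by simp [torsionSum]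
  rw [hsplit, h1, h2, h3]
  field_simp
  ring

end Formula

/-! ### Assembly of the theorem. -/

theorem StdPGroup.pow_eq_one {p s : ℕ} {α m : ℕ → ℕ} (h : IsTypeData s α m)
    (g : StdPGroup p s α m) : g ^ p ^ α 1 = 1 := by
  apply Multiplicative.toAdd.injective
  funext i j
  have hdvd : p ^ α i ∣ p ^ α 1 := pow_dvd_pow p (h.le_one (Finset.mem_Icc.1 i.2))
  change p ^ α 1 • (g.toAdd i j) = 0
  rw [nsmul_eq_mul, (ZMod.natCast_eq_zero_iff _ _).2 hdvd, zero_mul]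

theorem StdPGroup.isPGroup {p s : ℕ} {α m : ℕ → ℕ} (h : IsTypeData s α m) :
    IsPGroup p (StdPGroup p s α m) :=
  fun g => ⟨α 1, StdPGroup.pow_eq_one h g⟩

theorem numMaxCyclic_eq_indepFormula {p s : ℕ} {α m : ℕ → ℕ} (hp : p.Prime) (h : IsTypeData s α m)
    {G : Type*} [CommGroup G] (e : G ≃* StdPGroup p s α m) :
    (numMaxCyclic G : ℚ) = indepFormula p s α m := by
  have : Fact p.Prime := ⟨hp⟩
  have : ∀ i : Finset.Icc 1 s, NeZero (p ^ α i) := fun i => ⟨pow_ne_zero _ hp.ne_zero⟩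
  have hA : ∀ k, ((p : ℚ) ^ torsionExp s α m k) =
      Nat.card (powMonoidHom (p ^ k) : StdPGroup p s α m →* StdPGroup p s α m).ker := fun k => by
    rw [StdPGroup.card_ker_pow hp, Nat.cast_pow]
  -- The `p`-torsion alone has `p ^ rSum m s > 1` elements.
  have hnt : Nontrivial (StdPGroup p s α m) := by
    have h1 : 1 < Nat.card
        (powMonoidHom (p ^ 1) : StdPGroup p s α m →* StdPGroup p s α m).ker := by
      rw [StdPGroup.card_ker_pow hp, h.torsionExp_one]
      exact Nat.one_lt_pow (Nat.one_le_iff_ne_zero.1 (h.one_le_rSum h.one_le)) hp.one_lt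
    have := Finite.one_lt_card_iff_nontrivial.1 h1
    exact (Subgroup.subtype_injective
      (powMonoidHom (p ^ 1) : StdPGroup p s α m →* StdPGroup p s α m).ker).nontrivial
  rw [e.numMaxCyclic_eq, numMaxCyclic_eq_sum_card_torsion (α 1) (StdPGroup.pow_eq_one h) _ hA,
    sum_range_eq_torsionSum hp (fun e => (p : ℚ) ^ torsionExp s α m e), h.indepFormula_eq hp,
    h.torsionExp_one]
  · simp [torsionExp_zero]
  · exact pow_ne_zero _ (by exact_mod_cast hp.ne_zero)
  · simp only [h.torsionExp_of_le (Nat.le_succ _), h.torsionExp_of_le le_rfl]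

theorem mainTheorem4 :
    (∀ (p s : ℕ) (α m : ℕ → ℕ), p.Prime → IsTypeData s α m →
      ∀ (G : Type u) [CommGroup G], Nonempty (G ≃* StdPGroup p s α m) →
        ((powerGraph G).indepNum : ℚ) = indepFormula p s α m ∧
        ((enhancedPowerGraph G).indepNum : ℚ) = indepFormula p s α m ∧
        (numMaxCyclic G : ℚ) = indepFormula p s α m) ∧
    (∀ (G : Type u) [CommGroup G] [Finite G] (P : (p : ℕ) → Sylow p G),
      (enhancedPowerGraph G).indepNum = ∏ p ∈ (Nat.card G).primeFactors, numMaxCyclic (P p) ∧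
      ∀ (s : ℕ → ℕ) (α m : ℕ → ℕ → ℕ),
        (∀ p ∈ (Nat.card G).primeFactors, IsTypeData (s p) (α p) (m p) ∧
          Nonempty (P p ≃* StdPGroup p (s p) (α p) (m p))) →
        ((enhancedPowerGraph G).indepNum : ℚ) =
          ∏ p ∈ (Nat.card G).primeFactors, indepFormula p (s p) (α p) (m p)) := by
  refine ⟨?_, ?_⟩
  · rintro p s α m hp h G _ ⟨e⟩
    have : Fact p.Prime := ⟨hp⟩
    have : ∀ i : Finset.Icc 1 s, NeZero (p ^ α i) := fun i => ⟨pow_ne_zero _ hp.ne_zero⟩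
    have : Finite G := Finite.of_equiv _ e.symm.toEquiv
    have hG : IsPGroup p G :=
      (StdPGroup.isPGroup h).of_equiv e.symm
    rw [hG.powerGraph_eq_enhancedPowerGraph, indepNum_enhancedPowerGraph,
      numMaxCyclic_eq_indepFormula hp h e]
    exact ⟨rfl, rfl, rfl⟩
  · intro G _ _ P
    have hP := numMaxCyclic_eq_prod_sylow G P
    rw [indepNum_enhancedPowerGraph]
    refine ⟨hP, fun s α m h => ?_⟩
    rw [hP, Nat.cast_prod]
    refine Finset.prod_congr rfl fun p hp => ?_
    obtain ⟨hdata, ⟨e⟩⟩ := h p hp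
    exact numMaxCyclic_eq_indepFormula (Nat.prime_of_mem_primeFactors hp) hdata e
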